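/- Let $K$ be a field with $\operatorname{char} K \neq 2,3$. Let $E$ denote the Grassmann (exterior) algebra over a $K$-vector space of countably infinite dimension and, for $r\ge 0$, let $E_r$ denote the Grassmann algebra over an $r$-dimensional $K$-vector space. Long commutators are left-normed: $[x_1,x_2]=x_1x_2-x_2x_1$ and $[x_1,\dots,x_{p+1}]=[[x_1,\dots,x_p],x_{p+1}]$ for $p\ge 2$. A unital associative $K$-algebra $A$ satisfies the polynomial identity $f(x_1,\dots,x_m)=0$, where $f$ lies in the free unital associative $K$-algebra on $x_1,x_2,\dots$, if $f(a_1,\dots,a_m)=0$ for all $a_1,\dots,a_m\in A$. Let $k\ge 0$ be an integer and let $r=2k$ or $r=2k+1$. Then (with all tensor products taken over $K$ with their usual, ungraded, multiplication $(a\otimes b)(a'\otimes b')=aa'\otimes bb'$): - $E\otimes E_r\otimes E_2$ and $E\otimes E_r\otimes E_3$ satisfy the identity $[x_1,\dots,x_{2k+5}]=0$; - $E_r\otimes E_r\otimes E_2$ and $E_r\otimes E_r\otimes E_3$ satisfy the identity $[x_1,\dots,x_{2k+3}]=0$. -/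

import Mathlib

open scoped TensorProduct

/-- The left-normed long commutator `[u₁, …, u_n]`, where `u₁ = u 0`, `u₂ = u 1`, and so on:
`[u₁] = u₁` and `[u₁, …, u_{p+1}] = [[u₁, …, u_p], u_{p+1}]` with `[a, b] = a * b - b * a`.
(The empty commutator, of length `0`, is given the dummy value `0`.) -/
def longCommutator {A : Type*} [Ring A] (u : ℕ → A) : ℕ → A
  | 0 => 0
  | 1 => u 0
  | p + 2 => ⁅longCommutator u (p + 1), u (p + 1)⁆

/-- The unital associative `K`-algebra `A` satisfies the polynomial identity `f = 0`, where `f` is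
an element of the free unital associative algebra on a countably infinite set of variables:
every substitution of elements of `A` for the variables sends `f` to `0`. -/
def SatisfiesIdentity (K : Type*) [Field K] (A : Type*) [Ring A] [Algebra K A]
    (f : FreeAlgebra K ℕ) : Prop :=
  ∀ a : ℕ → A, FreeAlgebra.lift K a f = 0

/-- The polynomial `[x₁, …, x_q]` in the free unital associative algebra; the variable `x_i` is
the free generator with index `i - 1`. -/
noncomputable def commutatorPolynomial (K : Type*) [Field K] (q : ℕ) : FreeAlgebra K ℕ :=
  longCommutator (FreeAlgebra.ι K) q

/-- `E`: the Grassmann algebra over a vector space of countably infinite dimension. -/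
abbrev GrassmannInf (K : Type*) [Field K] : Type _ := ExteriorAlgebra K (ℕ →₀ K)

/-- `E_r`: the Grassmann algebra over an `r`-dimensional vector space. -/
abbrev GrassmannFin (K : Type*) [Field K] (r : ℕ) : Type _ := ExteriorAlgebra K (Fin r → K)

/-! Commutators are multilinear, so it suffices to bracket pure tensors of wedge monomials.
Multidegrees `(a, b, c)` and `(a', b', c')` commute up to the sign of `a * a' + b * b' + c * c'`. A
nonzero bracket makes this sum odd, so in some factor both degrees are odd, and adding them gains a
carry in the halved degree. Counting carries (`CommutatorDegreeBound.succ`) forces degrees to grow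
with the length of the commutator, while a monomial of degree above the dimension vanishes. -/

theorem map_longCommutator {K A B : Type*} [Field K] [Ring A] [Algebra K A] [Ring B] [Algebra K B]
    (φ : A →ₐ[K] B) (u : ℕ → A) (n : ℕ) :
    φ (longCommutator u n) = longCommutator (fun i => φ (u i)) n := by
  induction n with
  | zero => simp [longCommutator]
  | succ n ih =>
    cases n with
    | zero => simp [longCommutator]
    | succ n => simp only [longCommutator, Ring.lie_def, map_sub, map_mul, ih]

theorem satisfiesIdentity_commutatorPolynomial_iff {K A : Type*} [Field K] [Ring A] [Algebra K A]
    (n : ℕ) : SatisfiesIdentity K A (commutatorPolynomial K n) ↔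
      ∀ u : ℕ → A, longCommutator u n = 0 := by
  simp [SatisfiesIdentity, commutatorPolynomial, map_longCommutator]

/-- The bracket is the bilinear map `mul - mul.flip`. -/
theorem lie_mem_span_image2 {K A : Type*} [Field K] [Ring A] [Algebra K A] {s t : Set A} {x y : A}
    (hx : x ∈ Submodule.span K s) (hy : y ∈ Submodule.span K t) :
    ⁅x, y⁆ ∈ Submodule.span K (Set.image2 (fun x y => ⁅x, y⁆) s t) := by
  have h := Submodule.apply_mem_map₂ (LinearMap.mul K A - (LinearMap.mul K A).flip) hx hy
  rw [Submodule.map₂_span_span] at h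
  exact h

/-- The products `v₁ ∧ ⋯ ∧ v_n` of `n` vectors in the exterior algebra. -/
def wedgeMonomials (K V : Type*) [Field K] [AddCommGroup V] [Module K V] (n : ℕ) :
    Set (ExteriorAlgebra K V) :=
  {x | ∃ l : List V, l.length = n ∧ (l.map (ExteriorAlgebra.ι K)).prod = x}

section Wedge

variable {K V : Type*} [Field K] [AddCommGroup V] [Module K V]

theorem mul_mem_wedgeMonomials {m n : ℕ} {x y : ExteriorAlgebra K V}
    (hx : x ∈ wedgeMonomials K V m) (hy : y ∈ wedgeMonomials K V n) :
    x * y ∈ wedgeMonomials K V (m + n) := by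
  obtain ⟨l, rfl, rfl⟩ := hx
  obtain ⟨l', rfl, rfl⟩ := hy
  exact ⟨l ++ l', by simp, by simp⟩

theorem ι_mul_ι_eq_neg (v w : V) :
    ExteriorAlgebra.ι K v * ExteriorAlgebra.ι K w =
      -(ExteriorAlgebra.ι K w * ExteriorAlgebra.ι K v) :=
  eq_neg_of_add_eq_zero_left (ExteriorAlgebra.ι_add_mul_swap v w)

theorem ι_mul_wedge (v : V) (l : List V) :
    ExteriorAlgebra.ι K v * (l.map (ExteriorAlgebra.ι K)).prod =
      (-1 : K) ^ l.length • ((l.map (ExteriorAlgebra.ι K)).prod * ExteriorAlgebra.ι K v) := by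
  induction l with
  | nil => simp
  | cons w l ih =>
    rw [List.map_cons, List.prod_cons, ← mul_assoc, ι_mul_ι_eq_neg, neg_mul, mul_assoc, ih,
      List.length_cons, pow_succ]
    simp [mul_assoc]

theorem wedgeMonomials_mul_comm {m n : ℕ} {x y : ExteriorAlgebra K V}
    (hx : x ∈ wedgeMonomials K V m) (hy : y ∈ wedgeMonomials K V n) :
    y * x = (-1 : K) ^ (m * n) • (x * y) := by
  obtain ⟨l, rfl, rfl⟩ := hx
  obtain ⟨l', rfl, rfl⟩ := hy
  induction l' with
  | nil => simp
  | cons w l' ih =>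
    rw [List.map_cons, List.prod_cons, mul_assoc, ih, mul_smul_comm, ← mul_assoc, ι_mul_wedge,
      smul_mul_assoc, smul_smul, mul_assoc, List.length_cons, mul_add, mul_one, pow_add]

/-- More vectors than the dimension are linearly dependent, and `ιMulti` is alternating. -/
theorem wedgeMonomials_eq_zero [FiniteDimensional K V] {n : ℕ} (hn : Module.finrank K V < n)
    {x : ExteriorAlgebra K V} (hx : x ∈ wedgeMonomials K V n) : x = 0 := by
  obtain ⟨l, rfl, rfl⟩ := hx
  have h := (ExteriorAlgebra.ιMulti K l.length (M := V)).map_linearDependent l.get (fun hl => by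
    have := hl.fintype_card_le_finrank
    simp at this
    omega)
  rw [ExteriorAlgebra.ιMulti_apply] at h
  rw [← h]
  congr 1
  apply List.ext_getElem <;> simp

theorem span_wedgeMonomials :
    Submodule.span K (⋃ n, wedgeMonomials K V n) = ⊤ := by
  rw [eq_top_iff]
  rintro x -
  induction x using ExteriorAlgebra.induction with
  | algebraMap c =>
    rw [Algebra.algebraMap_eq_smul_one]
    exact Submodule.smul_mem _ _ (Submodule.subset_span (Set.mem_iUnion.2 ⟨0, [], rfl, rfl⟩))
  | ι v => exact Submodule.subset_span (Set.mem_iUnion.2 ⟨1, [v], rfl, by simp⟩)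
  | add x y hx hy => exact add_mem hx hy
  | mul x y hx hy =>
    have h := Submodule.mul_mem_mul hx hy
    rw [Submodule.span_mul_span] at h
    refine Submodule.span_mono ?_ h
    rintro _ ⟨x, hx, y, hy, rfl⟩
    obtain ⟨m, hm⟩ := Set.mem_iUnion.1 hx
    obtain ⟨n, hn⟩ := Set.mem_iUnion.1 hy
    exact Set.mem_iUnion.2 ⟨_, mul_mem_wedgeMonomials hm hn⟩

end Wedge

/-- The pure tensors of wedge monomials of degrees `a`, `b`, `c`. -/
def tensorMonomials (K U V W : Type*) [Field K] [AddCommGroup U] [Module K U] [AddCommGroup V]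
    [Module K V] [AddCommGroup W] [Module K W] (a b c : ℕ) :
    Set ((ExteriorAlgebra K U ⊗[K] ExteriorAlgebra K V) ⊗[K] ExteriorAlgebra K W) :=
  {t | ∃ x ∈ wedgeMonomials K U a, ∃ y ∈ wedgeMonomials K V b, ∃ z ∈ wedgeMonomials K W c,
    (x ⊗ₜ[K] y) ⊗ₜ[K] z = t}

/-- The constraints on the multidegree of a nonzero left-normed commutator of `n` tensor monomials
when the third exterior algebra has at most three generators. -/
def CommutatorDegreeBound (n a b c : ℕ) : Prop :=
  c ≤ 3 ∧ n + a % 2 + b % 2 ≤ b + 2 + 2 * (c / 2) ∧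
    2 * n + a % 2 + b % 2 ≤ a + b + 2 + 2 * (c / 2)

theorem commutatorDegreeBound_one {a b c : ℕ} (hc : c ≤ 3) : CommutatorDegreeBound 1 a b c := by
  refine ⟨hc, ?_, ?_⟩ <;> omega

/-- A carry in any factor raises the second bound by 1. For the first, a carry in `b` or `c` gains 2
and the parity of `a` costs at most 1; otherwise `a` and `a'` are both odd, and `a % 2` drops from 1
to 0. -/
theorem CommutatorDegreeBound.succ {n a b c a' b' c' : ℕ} (h : CommutatorDegreeBound n a b c)
    (hc : c + c' ≤ 3) (hodd : Odd (a * a' + b * b' + c * c')) :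
    CommutatorDegreeBound (n + 1) (a + a') (b + b') (c + c') := by
  obtain ⟨-, h₁, h₂⟩ := h
  have hp : (a % 2 * (a' % 2) + b % 2 * (b' % 2) + c % 2 * (c' % 2)) % 2 = 1 := by
    rw [← Nat.odd_iff.1 hodd]
    simp [Nat.add_mod, Nat.mul_mod]
  refine ⟨hc, ?_, ?_⟩ <;>
  -- Fixing the parities of `a`, `b`, `c` makes `hp` linear, as `omega` requires.
  rcases Nat.mod_two_eq_zero_or_one a with ha | ha <;>
  rcases Nat.mod_two_eq_zero_or_one b with hb | hb <;>
  rcases Nat.mod_two_eq_zero_or_one c with hc | hc <;>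
  simp only [ha, hb, hc, zero_mul, one_mul, zero_add, add_zero] at hp <;>
  omega

section Tensor

variable {K U V W : Type*} [Field K] [AddCommGroup U] [Module K U] [AddCommGroup V] [Module K V]
  [AddCommGroup W] [Module K W]

theorem mul_mem_tensorMonomials {a b c a' b' c' : ℕ}
    {s t : (ExteriorAlgebra K U ⊗[K] ExteriorAlgebra K V) ⊗[K] ExteriorAlgebra K W}
    (hs : s ∈ tensorMonomials K U V W a b c) (ht : t ∈ tensorMonomials K U V W a' b' c') :
    s * t ∈ tensorMonomials K U V W (a + a') (b + b') (c + c') := by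
  obtain ⟨x, hx, y, hy, z, hz, rfl⟩ := hs
  obtain ⟨x', hx', y', hy', z', hz', rfl⟩ := ht
  exact ⟨_, mul_mem_wedgeMonomials hx hx', _, mul_mem_wedgeMonomials hy hy', _,
    mul_mem_wedgeMonomials hz hz', by simp⟩

theorem tensorMonomials_mul_comm {a b c a' b' c' : ℕ}
    {s t : (ExteriorAlgebra K U ⊗[K] ExteriorAlgebra K V) ⊗[K] ExteriorAlgebra K W}
    (hs : s ∈ tensorMonomials K U V W a b c) (ht : t ∈ tensorMonomials K U V W a' b' c') :
    t * s = (-1 : K) ^ (a * a' + b * b' + c * c') • (s * t) := by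
  obtain ⟨x, hx, y, hy, z, hz, rfl⟩ := hs
  obtain ⟨x', hx', y', hy', z', hz', rfl⟩ := ht
  simp only [Algebra.TensorProduct.tmul_mul_tmul]
  rw [wedgeMonomials_mul_comm hx hx', wedgeMonomials_mul_comm hy hy',
    wedgeMonomials_mul_comm hz hz']
  simp only [TensorProduct.tmul_smul, ← TensorProduct.smul_tmul', smul_smul]
  congr 1
  ring

theorem tensorMonomials_eq_zero_left [FiniteDimensional K U] {a b c : ℕ}
    (h : Module.finrank K U < a)
    {t : (ExteriorAlgebra K U ⊗[K] ExteriorAlgebra K V) ⊗[K] ExteriorAlgebra K W}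
    (ht : t ∈ tensorMonomials K U V W a b c) : t = 0 := by
  obtain ⟨x, hx, y, hy, z, hz, rfl⟩ := ht
  simp [wedgeMonomials_eq_zero h hx]

theorem tensorMonomials_eq_zero_middle [FiniteDimensional K V] {a b c : ℕ}
    (h : Module.finrank K V < b)
    {t : (ExteriorAlgebra K U ⊗[K] ExteriorAlgebra K V) ⊗[K] ExteriorAlgebra K W}
    (ht : t ∈ tensorMonomials K U V W a b c) : t = 0 := by
  obtain ⟨x, hx, y, hy, z, hz, rfl⟩ := ht
  simp [wedgeMonomials_eq_zero h hy]

theorem tensorMonomials_eq_zero_right [FiniteDimensional K W] {a b c : ℕ}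
    (h : Module.finrank K W < c)
    {t : (ExteriorAlgebra K U ⊗[K] ExteriorAlgebra K V) ⊗[K] ExteriorAlgebra K W}
    (ht : t ∈ tensorMonomials K U V W a b c) : t = 0 := by
  obtain ⟨x, hx, y, hy, z, hz, rfl⟩ := ht
  simp [wedgeMonomials_eq_zero h hz]

theorem span_tensorMonomials :
    Submodule.span K {t | ∃ a b c, t ∈ tensorMonomials K U V W a b c} = ⊤ := by
  rw [eq_top_iff, ← TensorProduct.span_tmul_eq_top, Submodule.span_le]
  rintro _ ⟨p, z, rfl⟩
  have hp : p ∈ Submodule.span K {p | ∃ a b, ∃ x ∈ wedgeMonomials K U a,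
      ∃ y ∈ wedgeMonomials K V b, x ⊗ₜ[K] y = p} := by
    induction p with
    | zero => exact zero_mem _
    | add p q hp hq => exact add_mem hp hq
    | tmul x y =>
      have h := Submodule.apply_mem_map₂ (TensorProduct.mk K _ _)
        (span_wedgeMonomials (K := K) (V := U) ▸ Submodule.mem_top (x := x))
        (span_wedgeMonomials (K := K) (V := V) ▸ Submodule.mem_top (x := y))
      rw [Submodule.map₂_span_span] at h
      refine Submodule.span_mono ?_ h
      rintro _ ⟨x, hx, y, hy, rfl⟩
      obtain ⟨a, ha⟩ := Set.mem_iUnion.1 hx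
      obtain ⟨b, hb⟩ := Set.mem_iUnion.1 hy
      exact ⟨a, b, x, ha, y, hb, rfl⟩
  have h := Submodule.apply_mem_map₂ (TensorProduct.mk K _ _) hp
    (span_wedgeMonomials (K := K) (V := W) ▸ Submodule.mem_top (x := z))
  rw [Submodule.map₂_span_span] at h
  refine Submodule.span_mono ?_ h
  rintro _ ⟨_, ⟨a, b, x, hx, y, hy, rfl⟩, z, hz, rfl⟩
  obtain ⟨c, hc⟩ := Set.mem_iUnion.1 hz
  exact ⟨a, b, c, x, hx, y, hy, z, hc, rfl⟩

theorem longCommutator_mem_span [FiniteDimensional K W] (hW : Module.finrank K W ≤ 3)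
    (u : ℕ → (ExteriorAlgebra K U ⊗[K] ExteriorAlgebra K V) ⊗[K] ExteriorAlgebra K W) (n : ℕ) :
    longCommutator u (n + 1) ∈ Submodule.span K
      {t | ∃ a b c, t ∈ tensorMonomials K U V W a b c ∧ CommutatorDegreeBound (n + 1) a b c} := by
  have htop (t : (ExteriorAlgebra K U ⊗[K] ExteriorAlgebra K V) ⊗[K] ExteriorAlgebra K W) :
      t ∈ Submodule.span K {t | ∃ a b c, t ∈ tensorMonomials K U V W a b c} :=
    span_tensorMonomials (K := K) (U := U) (V := V) (W := W) ▸ Submodule.mem_top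
  induction n with
  | zero =>
    refine Submodule.span_le.2 ?_ (htop (u 0))
    rintro t ⟨a, b, c, ht⟩
    by_cases hc : c ≤ 3
    · exact Submodule.subset_span ⟨a, b, c, ht, commutatorDegreeBound_one hc⟩
    · rw [tensorMonomials_eq_zero_right (by omega) ht]
      exact zero_mem _
  | succ n ih =>
    refine Submodule.span_le.2 ?_ (lie_mem_span_image2 ih (htop (u (n + 1))))
    rintro _ ⟨s, ⟨a, b, c, hs, hbound⟩, t, ⟨a', b', c', ht⟩, rfl⟩
    simp only [SetLike.mem_coe, Ring.lie_def]
    rw [tensorMonomials_mul_comm hs ht]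
    have hst := mul_mem_tensorMonomials hs ht
    rcases Nat.even_or_odd (a * a' + b * b' + c * c') with he | ho
    -- Even exponent: the two monomials commute.
    · simp [he.neg_one_pow]
    · by_cases hc : c + c' ≤ 3
      · have hmem := Submodule.subset_span (R := K)
          (s := {t | ∃ a b c, t ∈ tensorMonomials K U V W a b c ∧
            CommutatorDegreeBound (n + 1 + 1) a b c})
          ⟨_, _, _, hst, hbound.succ hc ho⟩
        exact sub_mem hmem (Submodule.smul_mem _ _ hmem)
      · rw [tensorMonomials_eq_zero_right (by omega) hst]
        simp

theorem longCommutator_eq_zero_of_finrank_middle [FiniteDimensional K V] [FiniteDimensional K W]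
    {k : ℕ} (hV : Module.finrank K V ≤ 2 * k + 1) (hW : Module.finrank K W ≤ 3)
    (u : ℕ → (ExteriorAlgebra K U ⊗[K] ExteriorAlgebra K V) ⊗[K] ExteriorAlgebra K W) :
    longCommutator u (2 * k + 5) = 0 := by
  rw [← Submodule.mem_bot K]
  refine Submodule.span_le.2 ?_ (longCommutator_mem_span hW u (2 * k + 4))
  rintro t ⟨a, b, c, ht, hc, h, -⟩
  -- With `b ≤ 2 * k + 1` and `c ≤ 3`, the first bound would give length at most `2 * k + 2 + 2`.
  exact tensorMonomials_eq_zero_middle (by omega) ht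

theorem longCommutator_eq_zero_of_finrank_left_middle [FiniteDimensional K U]
    [FiniteDimensional K V] [FiniteDimensional K W] {k : ℕ}
    (hU : Module.finrank K U ≤ 2 * k + 1) (hV : Module.finrank K V ≤ 2 * k + 1)
    (hW : Module.finrank K W ≤ 3)
    (u : ℕ → (ExteriorAlgebra K U ⊗[K] ExteriorAlgebra K V) ⊗[K] ExteriorAlgebra K W) :
    longCommutator u (2 * k + 3) = 0 := by
  rw [← Submodule.mem_bot K]
  refine Submodule.span_le.2 ?_ (longCommutator_mem_span hW u (2 * k + 2))
  rintro t ⟨a, b, c, ht, hc, -, h⟩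
  -- If `a` and `b` were both at most `2 * k + 1`, the second bound would give length at most `k + k
  -- + 1 + 1`.
  by_cases ha : a ≤ 2 * k + 1
  · exact tensorMonomials_eq_zero_middle (by omega) ht
  · exact tensorMonomials_eq_zero_left (by omega) ht

end Tensor

theorem corollary2p9 {K : Type*} [Field K] (h2 : ringChar K ≠ 2) (h3 : ringChar K ≠ 3)
    (k r : ℕ) (hr : r = 2 * k ∨ r = 2 * k + 1) :
    SatisfiesIdentity K ((GrassmannInf K ⊗[K] GrassmannFin K r) ⊗[K] GrassmannFin K 2)
        (commutatorPolynomial K (2 * k + 5)) ∧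
      SatisfiesIdentity K ((GrassmannInf K ⊗[K] GrassmannFin K r) ⊗[K] GrassmannFin K 3)
        (commutatorPolynomial K (2 * k + 5)) ∧
      SatisfiesIdentity K ((GrassmannFin K r ⊗[K] GrassmannFin K r) ⊗[K] GrassmannFin K 2)
        (commutatorPolynomial K (2 * k + 3)) ∧
      SatisfiesIdentity K ((GrassmannFin K r ⊗[K] GrassmannFin K r) ⊗[K] GrassmannFin K 3)
        (commutatorPolynomial K (2 * k + 3)) := by
  have hV : Module.finrank K (Fin r → K) ≤ 2 * k + 1 := by
    rw [Module.finrank_fin_fun]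
    omega
  simp only [satisfiesIdentity_commutatorPolynomial_iff]
  exact ⟨longCommutator_eq_zero_of_finrank_middle hV (by simp),
    longCommutator_eq_zero_of_finrank_middle hV (by simp),
    longCommutator_eq_zero_of_finrank_left_middle hV hV (by simp),
    longCommutator_eq_zero_of_finrank_left_middle hV hV (by simp)⟩
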